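/- Call a finite simple graph $G$ prolific if it is connected and is not isomorphic to a path $P_m$ ($m\ge 1$ vertices), to a cycle $C_m$ ($m\ge 3$), or to the star $K_{1,3}$. The line graph $L(G)$ has as its vertices the edges of $G$, two distinct ones being adjacent if they share an endpoint; put $L^0(G)=G$ and $L^k(G)=L(L^{k-1}(G))$ for $k\ge 1$. Theorem 2.3 (all fifteen parameters unbounded). For every prolific graph $G$ and each of the following fifteen graph parameters $P$, $P(L^k(G))\to\infty$ as $k\to\infty$: 1. $n$, the number of vertices; 2. $e$, the number of edges; 3. $\Delta$, the maximum degree; 4. $\delta$, the minimum degree; 5. $d$, the average degree; 6. $c$, the length of a longest cycle ($0$ if there is none); 7. $\mu$, the matching number (largest number of edges in a matching); 8. $\chi$, the chromatic number; 9. $\chi'$, the chromatic index (least number of colours in a proper edge colouring); 10. $\omega$, the clique number; 11. $\lambda$, the edge connectivity (least number of edges whose deletion disconnects the graph; $0$ for a single vertex); 12. $\kappa$, the vertex connectivity (least number of vertices whose deletion leaves a graph that is disconnected or has only one vertex); 13. $\alpha$, the independence number (largest size of an independent set); 14. $i$, the independent domination number (least size of a dominating set that is independent); 15. $\gamma$,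 the domination number (least size of a set $D$ of vertices such that every vertex outside $D$ has a neighbour in $D$). -/

import Mathlib

open Filter

universe u

/-- A finite simple graph, bundled with its vertex type. -/
structure FinGraph where
  /-- the vertices -/
  V : Type u
  [finite : Finite V]
  /-- the graph -/
  graph : SimpleGraph V

namespace FinGraph

instance instFiniteV (G : FinGraph.{u}) : Finite G.V := G.finite

noncomputable instance instFintypeV (G : FinGraph.{u}) : Fintype G.V := Fintype.ofFinite G.V

/-- The line graph `L(G)`; the `k`-th iterated line graph `L^k(G)` is `lineGraph^[k] G`. -/
def lineGraph (G : FinGraph.{u}) : FinGraph.{u} where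
  V := G.graph.edgeSet
  graph := G.graph.lineGraph

/-- A prolific graph: connected (in particular nonempty), and isomorphic neither to a path, nor to
a cycle, nor to the star `K_{1,3}`. -/
structure Prolific (G : FinGraph.{u}) : Prop where
  connected : G.graph.Connected
  not_path : ∀ n : ℕ, IsEmpty (G.graph ≃g SimpleGraph.pathGraph n)
  not_cycle : ∀ n : ℕ, 3 ≤ n → IsEmpty (G.graph ≃g SimpleGraph.cycleGraph n)
  not_claw : IsEmpty (G.graph ≃g completeBipartiteGraph (Fin 1) (Fin 3))

/-- A graph parameter `P` is unbounded if `P(L^k(G)) → ∞` as `k → ∞` for every prolific `G`. -/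
def IsUnbounded {α : Type*} [Preorder α] (P : FinGraph.{u} → α) : Prop :=
  ∀ G : FinGraph.{u}, G.Prolific → Tendsto (fun k : ℕ => P (lineGraph^[k] G)) atTop atTop

/-- `n(G)`, the number of vertices. -/
noncomputable def numVertices (G : FinGraph.{u}) : ℕ := Nat.card G.V

/-- `e(G)`, the number of edges. -/
noncomputable def numEdges (G : FinGraph.{u}) : ℕ := G.graph.edgeSet.ncard

open Classical in
/-- `Δ(G)`, the maximum degree. -/
noncomputable def maxDegree (G : FinGraph.{u}) : ℕ := G.graph.maxDegree

open Classical in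
/-- `δ(G)`, the minimum degree. -/
noncomputable def minDegree (G : FinGraph.{u}) : ℕ := G.graph.minDegree

open Classical in
/-- `d(G)`, the average degree. -/
noncomputable def averageDegree (G : FinGraph.{u}) : ℝ :=
  (∑ v : G.V, (G.graph.degree v : ℝ)) / (Fintype.card G.V : ℝ)

/-- `c(G)`, the length of a longest cycle (`0` if there is no cycle). -/
noncomputable def longestCycle (G : FinGraph.{u}) : ℕ :=
  sSup {l : ℕ | ∃ (v : G.V) (w : G.graph.Walk v v), w.IsCycle ∧ w.length = l}

/-- `μ(G)`, the largest number of edges in a matching. -/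
noncomputable def matchingNumber (G : FinGraph.{u}) : ℕ :=
  sSup {m : ℕ | ∃ M : G.graph.Subgraph, M.IsMatching ∧ M.edgeSet.ncard = m}

/-- `χ(G)`, the chromatic number, which is finite as the graph is finite. -/
noncomputable def chromaticNumber (G : FinGraph.{u}) : ℕ := G.graph.chromaticNumber.toNat

/-- `χ'(G)`, the chromatic index: the least number of colours in an edge colouring in which any two
distinct edges with a common endpoint have different colours. -/
noncomputable def chromaticIndex (G : FinGraph.{u}) : ℕ :=
  sInf {m : ℕ | ∃ c : G.graph.edgeSet → Fin m, ∀ e f : G.graph.edgeSet, e ≠ f →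
    (∃ v : G.V, v ∈ (e : Sym2 G.V) ∧ v ∈ (f : Sym2 G.V)) → c e ≠ c f}

/-- `ω(G)`, the clique number. -/
noncomputable def cliqueNumber (G : FinGraph.{u}) : ℕ := G.graph.cliqueNum

/-- `λ(G)`, the edge connectivity: the least number of edges whose deletion leaves a disconnected
graph (`0` for a one-vertex graph). -/
noncomputable def edgeConnectivity (G : FinGraph.{u}) : ℕ :=
  sInf {m : ℕ | ∃ S : Set (Sym2 G.V), S ⊆ G.graph.edgeSet ∧
    ¬ (G.graph.deleteEdges S).Connected ∧ S.ncard = m}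

/-- `κ(G)`, the vertex connectivity: the least number of vertices whose deletion leaves a graph that
is disconnected or has only one vertex. -/
noncomputable def vertexConnectivity (G : FinGraph.{u}) : ℕ :=
  sInf {m : ℕ | ∃ S : Set G.V,
    (¬ (G.graph.induce Sᶜ).Preconnected ∨ Sᶜ.ncard = 1) ∧ S.ncard = m}

/-- `α(G)`, the independence number. -/
noncomputable def independenceNumber (G : FinGraph.{u}) : ℕ := G.graph.indepNum

/-- `D` is a dominating set: every vertex outside `D` has a neighbour in `D`. -/
def IsDominating (G : FinGraph.{u}) (D : Set G.V) : Prop :=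
  ∀ v : G.V, v ∉ D → ∃ u ∈ D, G.graph.Adj u v

/-- `i(G)`, the independent domination number: the least size of an independent dominating set. -/
noncomputable def independentDominationNumber (G : FinGraph.{u}) : ℕ :=
  sInf {m : ℕ | ∃ D : Set G.V, G.graph.IsIndepSet D ∧ G.IsDominating D ∧ D.ncard = m}

/-- `γ(G)`, the domination number: the least size of a dominating set. -/
noncomputable def dominationNumber (G : FinGraph.{u}) : ℕ :=
  sInf {m : ℕ | ∃ D : Set G.V, G.IsDominating D ∧ D.ncard = m}

end FinGraph

/-! Everything rests on the growth of the minimum degree δ. An edge xy has degree deg x + deg y - 2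
in the line graph, so once δ ≥ 3 it increases at every step, because 2δ - 2 > δ. To reach δ ≥ 3,
call a ball thin if all its vertices have degree at most two. A thin ball of positive radius in
L²(G) yields one of radius larger by one in G (`exists_thin_succ`). But a prolific G has a vertex of
degree at least three, hence no thin ball of radius |V|. So thin balls of radius one die out, and δ
≥ 3 follows a few steps later.

The other parameters are compared with δ. It bounds Δ, d and χ' from below; n > Δ, and e(G) =
n(L(G)). The edges at a vertex form a clique of L(G), which gives ω, then χ and c. Moreover λ(L(G))
≥ δ(G) - 1 and κ(L(G)) ≥ λ(G). For γ, the ratio n/(Δ + 1) at least doubles at each step once δ ≥ 8;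
then γ ≤ i ≤ α, and α(L(G)) ≤ μ(G). -/

namespace SimpleGraph

variable {V : Type*} {G : SimpleGraph V}

/-! ### Degrees in graphs and line graphs -/

/-- The degree of a vertex, as the cardinality of its neighbour set. -/
noncomputable def ndeg (G : SimpleGraph V) (v : V) : ℕ := (G.neighborSet v).ncard

theorem ndeg_eq_degree (v : V) [Fintype (G.neighborSet v)] : G.ndeg v = G.degree v := by
  rw [ndeg, Set.ncard_eq_toFinset_card', ← card_neighborSet_eq_degree, Set.toFinset_card]

theorem Iso.ndeg_eq {W : Type*} {H : SimpleGraph W} (f : G ≃g H) (v : V) :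
    H.ndeg (f v) = G.ndeg v := by
  have : H.neighborSet (f v) = f '' G.neighborSet v := by
    ext w
    obtain ⟨w, rfl⟩ := f.surjective w
    simp [f.map_adj_iff]
  rw [ndeg, this, Set.ncard_image_of_injective _ f.injective, ndeg]

theorem ncard_incidenceSet (v : V) : (G.incidenceSet v).ncard = G.ndeg v := by
  classical
  exact Nat.card_congr (G.incidenceSetEquivNeighborSet v)

theorem Connected.eq_univ_of_forall_adj (hG : G.Connected) {S : Set V} (hne : S.Nonempty)
    (hS : ∀ x ∈ S, ∀ y, G.Adj x y → y ∈ S) : S = Set.univ := by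
  obtain ⟨x, hx⟩ := hne
  refine Set.eq_univ_of_forall fun y => ?_
  obtain ⟨p⟩ := hG.preconnected x y
  induction p with
  | nil => exact hx
  | cons h _ ih => exact ih (hS _ hx _ h)

variable [Finite V]

/-- The edge xy lies in both incidence sets and is not its own neighbour, so it is counted twice too
often. -/
theorem ndeg_lineGraph {x y : V} (h : s(x, y) ∈ G.edgeSet) :
    G.lineGraph.ndeg ⟨s(x, y), h⟩ + 2 = G.ndeg x + G.ndeg y := by
  have h1 : Subtype.val '' (G.lineGraph.neighborSet ⟨s(x, y), h⟩) =
      (G.incidenceSet x ∪ G.incidenceSet y) \ {s(x, y)} := by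
    ext f
    simp only [Set.mem_image, mem_neighborSet, lineGraph_adj_iff_exists, Subtype.exists,
      incidenceSet, Set.mem_sdiff, Set.mem_union, Set.mem_ofPred_eq, Set.mem_singleton_iff]
    constructor
    · rintro ⟨a, ha, ⟨hne, v, hv, hva⟩, rfl⟩
      rw [Sym2.mem_iff] at hv
      refine ⟨?_, fun h' => hne (Subtype.ext h'.symm)⟩
      rcases hv with rfl | rfl
      · exact .inl ⟨ha, hva⟩
      · exact .inr ⟨ha, hva⟩
    · rintro ⟨hf, hne⟩
      have hfe : f ∈ G.edgeSet := by tauto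
      refine ⟨f, hfe, ⟨fun h' => hne (congrArg Subtype.val h').symm, ?_⟩, rfl⟩
      rcases hf with hf | hf
      · exact ⟨x, by simp, hf.2⟩
      · exact ⟨y, by simp, hf.2⟩
  have h2 : G.lineGraph.ndeg ⟨s(x, y), h⟩ =
      ((G.incidenceSet x ∪ G.incidenceSet y) \ {s(x, y)}).ncard := by
    rw [← h1, Set.ncard_image_of_injective _ Subtype.val_injective, ndeg]
  have h3 := Set.ncard_union_add_ncard_inter (G.incidenceSet x) (G.incidenceSet y)
  rw [G.incidenceSet_inter_incidenceSet_of_adj h, Set.ncard_singleton, ncard_incidenceSet,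
    ncard_incidenceSet] at h3
  have hmem : s(x, y) ∈ G.incidenceSet x ∪ G.incidenceSet y := .inl ⟨h, by simp⟩
  have h4 := Set.ncard_sdiff_singleton_add_one hmem
  omega

theorem ndeg_pos {v w : V} (h : G.Adj v w) : 1 ≤ G.ndeg v :=
  (Set.ncard_pos (Set.toFinite _)).2 ⟨w, h⟩

theorem two_le_ndeg {v a b : V} (ha : G.Adj v a) (hb : G.Adj v b) (hab : a ≠ b) :
    2 ≤ G.ndeg v := (Set.one_lt_ncard (Set.toFinite _)).2 ⟨a, ha, b, hb, hab⟩

theorem three_le_ndeg {v a b c : V} (ha : G.Adj v a) (hb : G.Adj v b) (hc : G.Adj v c)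
    (hab : a ≠ b) (hac : a ≠ c) (hbc : b ≠ c) : 3 ≤ G.ndeg v :=
  (Set.two_lt_ncard_iff (Set.toFinite _)).2 ⟨a, b, c, ha, hb, hc, hab, hac, hbc⟩

theorem eq_or_eq_of_ndeg_le_two {v a b c : V} (h : G.ndeg v ≤ 2) (ha : G.Adj v a)
    (hb : G.Adj v b) (hab : a ≠ b) (hc : G.Adj v c) : c = a ∨ c = b := by
  by_contra! h'
  have := three_le_ndeg ha hb hc hab h'.1.symm h'.2.symm
  omega

theorem exists_adj_adj_of_two_le_ndeg {v : V} (h : 2 ≤ G.ndeg v) :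
    ∃ a b, G.Adj v a ∧ G.Adj v b ∧ a ≠ b := by
  obtain ⟨a, b, ha, hb, hab⟩ := (Set.one_lt_ncard_iff (Set.toFinite _)).1 h
  exact ⟨a, b, ha, hb, hab⟩

/-! ### Connected graphs of maximum degree two -/

/-- A finite connected graph with all degrees at most two is a path or a cycle. -/
theorem Connected.exists_iso_path_or_cycle (hG : G.Connected) (h : ∀ v, G.ndeg v ≤ 2) :
    (∃ n, Nonempty (G ≃g pathGraph n)) ∨ ∃ n, 3 ≤ n ∧ Nonempty (G ≃g cycleGraph n) := by
  have := hG.nonempty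
  -- In a longest path the ends have no neighbour off the path, and interior vertices already have
  -- their two neighbours on it; by connectedness it covers the graph.
  obtain ⟨u, v, p, hp, hmax⟩ :=
    Walk.exists_isPath_forall_isPath_length_le_length G
  have hinj : ∀ i j, i ≤ p.length → j ≤ p.length → p.getVert i = p.getVert j → i = j :=
    fun i j hi hj hij => hp.getVert_injOn hi hj hij
  have hadj : ∀ i, i < p.length → G.Adj (p.getVert i) (p.getVert (i + 1)) :=
    fun i hi => p.adj_getVert_succ hi
  have hint : ∀ i, 0 < i → i < p.length → ∀ w, G.Adj (p.getVert i) w →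
      w = p.getVert (i - 1) ∨ w = p.getVert (i + 1) := by
    intro i h0 hi w hw
    have h1 := hadj (i - 1) (by omega)
    rw [Nat.sub_add_cancel h0] at h1
    refine eq_or_eq_of_ndeg_le_two (h _) h1.symm (hadj i hi) (fun h' => ?_) hw
    have := hinj _ _ (by omega) (by omega) h'
    omega
  have hstart : ∀ w, G.Adj u w → w ∈ p.support := by
    intro w hw
    by_contra hn
    have := hmax w v (p.cons hw.symm) (hp.cons hn)
    simp at this
  have hend : ∀ w, G.Adj v w → w ∈ p.support := by
    intro w hw
    by_contra hn
    have := hmax u w (p.concat hw) (hp.concat hn hw)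
    simp at this
  have hsupp : ∀ w, ∃ i, i ≤ p.length ∧ p.getVert i = w := by
    have : {w | w ∈ p.support} = Set.univ := by
      refine hG.eq_univ_of_forall_adj ⟨u, p.start_mem_support⟩ fun x hx y hxy => ?_
      obtain ⟨i, rfl, hi⟩ := Walk.mem_support_iff_exists_getVert.1 hx
      rcases Nat.eq_zero_or_pos i with rfl | h0
      · exact hstart y (by simpa using hxy)
      rcases hi.eq_or_lt with rfl | hi
      · exact hend y (by simpa using hxy)
      rcases hint i h0 hi y hxy with rfl | rfl <;> exact p.getVert_mem_support _
    intro w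
    obtain ⟨i, hi, hil⟩ := Walk.mem_support_iff_exists_getVert.1
      (this ▸ Set.mem_univ w : w ∈ {w | w ∈ p.support})
    exact ⟨i, hil, hi⟩
  let f : Fin (p.length + 1) ≃ V := Equiv.ofBijective (fun i => p.getVert i)
    ⟨fun i j hij => Fin.ext (hinj _ _ (by omega) (by omega) hij), fun w => by
      obtain ⟨i, hi, hw⟩ := hsupp w
      exact ⟨⟨i, by omega⟩, hw⟩⟩
  have key : ∀ i j, i ≤ p.length → j ≤ p.length → G.Adj (p.getVert i) (p.getVert j) →
      i + 1 = j ∨ j + 1 = i ∨ (i = 0 ∧ j = p.length) ∨ (j = 0 ∧ i = p.length) := by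
    intro i j hi hj hij
    by_cases h1 : 0 < i ∧ i < p.length
    · rcases hint i h1.1 h1.2 _ hij with h' | h'
      · have := hinj _ _ hj (by omega) h'
        omega
      · have := hinj _ _ hj (by omega) h'
        omega
    by_cases h2 : 0 < j ∧ j < p.length
    · rcases hint j h2.1 h2.2 _ hij.symm with h' | h'
      · have := hinj _ _ hi (by omega) h'
        omega
      · have := hinj _ _ hi (by omega) h'
        omega
    have : i ≠ j := by rintro rfl; exact hij.ne rfl
    omega
  -- By `key`, only the two ends can be adjacent without being consecutive. Length at least two
  -- excludes a single edge, whose ends are consecutive anyway.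
  by_cases hc : 2 ≤ p.length ∧ G.Adj u v
  · refine .inr ⟨p.length + 1, by omega, ⟨Iso.symm ⟨f, fun {i j} => ?_⟩⟩⟩
    obtain ⟨i, hi⟩ := i
    obtain ⟨j, hj⟩ := j
    have huv : G.Adj (p.getVert 0) (p.getVert p.length) := by simpa using hc.2
    have hs : ∀ a b : ℕ, a ≤ p.length → b ≤ p.length →
        ((p.length + 1 - b + a) % (p.length + 1) = 1 ↔ b + 1 = a ∨ (a = 0 ∧ b = p.length)) := by
      intro a b ha hb
      rcases lt_or_ge a b with hab | hab
      · rw [Nat.mod_eq_of_lt (by omega)]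
        omega
      · rw [show p.length + 1 - b + a = (a - b) + (p.length + 1) by omega, Nat.add_mod_right,
          Nat.mod_eq_of_lt (by omega)]
        omega
    rw [cycleGraph_adj', Fin.val_sub, Fin.val_sub]
    simp only [hs i j (by omega) (by omega), hs j i (by omega) (by omega)]
    change G.Adj (p.getVert i) (p.getVert j) ↔ _
    constructor
    · intro hij
      have := key i j (by omega) (by omega) hij
      omega
    · rintro ((rfl | ⟨rfl, rfl⟩) | (rfl | ⟨rfl, rfl⟩))
      · exact (hadj _ (by omega)).symm
      · exact huv
      · exact hadj _ (by omega)
      · exact huv.symm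
  · refine .inl ⟨p.length + 1, ⟨Iso.symm ⟨f, fun {i j} => ?_⟩⟩⟩
    obtain ⟨i, hi⟩ := i
    obtain ⟨j, hj⟩ := j
    rw [pathGraph_adj]
    change G.Adj (p.getVert i) (p.getVert j) ↔ i + 1 = j ∨ j + 1 = i
    constructor
    · intro hij
      have hk := key i j (by omega) (by omega) hij
      have hne : i ≠ j := by rintro rfl; exact hij.ne rfl
      by_contra hcon
      refine hc ⟨by omega, ?_⟩
      have : (i = 0 ∧ j = p.length) ∨ (j = 0 ∧ i = p.length) := by omega
      rcases this with ⟨rfl, rfl⟩ | ⟨rfl, rfl⟩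
      · simpa using hij
      · simpa using hij.symm
    · rintro (rfl | rfl)
      · exact hadj _ (by omega)
      · exact (hadj _ (by omega)).symm

end SimpleGraph

/-! ### Structure of line graphs; the claw -/

namespace SimpleGraph

variable {V : Type*} {G : SimpleGraph V}

/-- Two distinct edges with a common endpoint are adjacent in the line graph. -/
theorem lineGraph_adj_of_adj {x y z : V} (hy : G.Adj x y) (hz : G.Adj x z) (hyz : y ≠ z) :
    G.lineGraph.Adj ⟨s(x, y), hy⟩ ⟨s(x, z), hz⟩ := by
  rw [lineGraph_adj_iff_exists]
  refine ⟨fun h => hyz ?_, x, by simp, by simp⟩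
  exact Sym2.congr_right.1 (congrArg Subtype.val h)

/-- Adjacent vertices of the line graph are edges `yx`, `yz` with `x ≠ z`. -/
theorem exists_of_lineGraph_adj {e f : G.edgeSet} (h : G.lineGraph.Adj e f) :
    ∃ (y x z : V) (hx : G.Adj y x) (hz : G.Adj y z), x ≠ z ∧ e = ⟨s(y, x), hx⟩ ∧
      f = ⟨s(y, z), hz⟩ := by
  rw [lineGraph_adj_iff_exists] at h
  obtain ⟨hne, y, ⟨x, hx⟩, ⟨z, hz⟩⟩ := h
  obtain ⟨e, he⟩ := e
  obtain ⟨f, hf⟩ := f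
  dsimp only at hx hz
  subst hx hz
  refine ⟨y, x, z, he, hf, ?_, rfl, rfl⟩
  rintro rfl
  exact hne rfl

/-- Edges at a common vertex are equal or adjacent in the line graph, so a walk joining endpoints of
two edges turns into a walk joining the edges. -/
theorem Preconnected.lineGraph (hG : G.Preconnected) : G.lineGraph.Preconnected := by
  have key : ∀ {x y : V} (_ : G.Walk x y) (a b : V) (ha : G.Adj x a) (hb : G.Adj y b),
      G.lineGraph.Reachable ⟨s(x, a), ha⟩ ⟨s(y, b), hb⟩ := by
    intro x y p
    induction p with
    | @nil x =>
      intro a b ha hb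
      by_cases hab : a = b
      · subst hab; rfl
      · exact (lineGraph_adj_of_adj ha hb hab).reachable
    | @cons x z y hxz p ih =>
      intro a b ha hb
      refine Reachable.trans ?_ (ih x b hxz.symm hb)
      have : (⟨s(z, x), hxz.symm⟩ : G.edgeSet) = ⟨s(x, z), hxz⟩ := Subtype.ext Sym2.eq_swap
      rw [this]
      by_cases haz : a = z
      · subst haz; rfl
      · exact (lineGraph_adj_of_adj ha hxz haz).reachable
  rintro ⟨⟨x, a⟩, ha⟩ ⟨⟨y, b⟩, hb⟩
  obtain ⟨p⟩ := hG x y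
  exact key p a b ha hb

/-- No vertex of a line graph has three pairwise nonadjacent neighbours. -/
theorem lineGraph_claw_free {e f₁ f₂ f₃ : G.edgeSet} (h₁ : G.lineGraph.Adj e f₁)
    (h₂ : G.lineGraph.Adj e f₂) (h₃ : G.lineGraph.Adj e f₃) (h₁₂ : f₁ ≠ f₂) (h₁₃ : f₁ ≠ f₃)
    (h₂₃ : f₂ ≠ f₃) :
    G.lineGraph.Adj f₁ f₂ ∨ G.lineGraph.Adj f₁ f₃ ∨ G.lineGraph.Adj f₂ f₃ := by
  simp only [lineGraph_adj_iff_exists] at *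
  obtain ⟨⟨x, y⟩, he⟩ := e
  obtain ⟨-, a, ha, ha'⟩ := h₁
  obtain ⟨-, b, hb, hb'⟩ := h₂
  obtain ⟨-, c, hc, hc'⟩ := h₃
  -- Pigeonhole: three shared endpoints among the two ends of `e`.
  have hab : a = b ∨ a = c ∨ b = c := by
    have ha := Sym2.mem_iff.1 ha
    have hb := Sym2.mem_iff.1 hb
    have hc := Sym2.mem_iff.1 hc
    grind
  rcases hab with rfl | rfl | rfl
  · exact .inl ⟨h₁₂, a, ha', hb'⟩
  · exact .inr (.inl ⟨h₁₃, a, ha', hc'⟩)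
  · exact .inr (.inr ⟨h₂₃, b, hb', hc'⟩)

section Finite

variable [Finite V]

theorem ndeg_pathGraph_le {n : ℕ} (v : Fin n) : (pathGraph n).ndeg v ≤ 2 := by
  by_contra! h
  obtain ⟨a, b, c, ha, hb, hc, hab, hac, hbc⟩ := (Set.two_lt_ncard_iff (Set.toFinite _)).1 h
  simp only [mem_neighborSet, pathGraph_adj] at ha hb hc
  omega

theorem ndeg_cycleGraph_le {n : ℕ} (hn : 3 ≤ n) (v : Fin n) : (cycleGraph n).ndeg v ≤ 2 := by
  obtain ⟨n, rfl⟩ := Nat.exists_eq_add_of_le' hn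
  rw [ndeg_eq_degree, cycleGraph_degree_three_le]

theorem Connected.exists_iso_claw (hG : G.Connected) {x : V} (hx : G.ndeg x = 3)
    (h : ∀ w, G.Adj x w → G.ndeg w ≤ 1) :
    Nonempty (G ≃g completeBipartiteGraph (Fin 1) (Fin 3)) := by
  have hleaf : ∀ w, G.Adj x w → ∀ z, G.Adj w z → z = x := by
    intro w hw z hz
    by_contra hne
    have := two_le_ndeg hz hw.symm hne
    have := h w hw
    omega
  have huniv : insert x (G.neighborSet x) = Set.univ := by
    refine hG.eq_univ_of_forall_adj (Set.insert_nonempty _ _) ?_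
    rintro y (rfl | hy) z hz
    · exact .inr hz
    · exact .inl (hleaf y hy z hz)
  have g : Fin 3 ≃ G.neighborSet x := (Finite.equivFinOfCardEq hx).symm
  let f : Fin 1 ⊕ Fin 3 → V := Sum.elim (fun _ => x) (fun i => (g i : V))
  have hf : Function.Bijective f := by
    constructor
    · rintro (i | i) (j | j) hij
      · exact congrArg _ (Subsingleton.elim _ _)
      · exact absurd (show x = (g j : V) from hij) (g j).2.ne
      · exact absurd (show (g i : V) = x from hij) (g i).2.ne'
      · exact congrArg _ (g.injective (Subtype.ext hij))
    · intro w
      have hw : w ∈ insert x (G.neighborSet x) := huniv ▸ Set.mem_univ w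
      rcases hw with rfl | hw
      · exact ⟨.inl 0, rfl⟩
      · exact ⟨.inr (g.symm ⟨w, hw⟩), by simp [f]⟩
  refine ⟨Iso.symm ⟨Equiv.ofBijective f hf, fun {a b} => ?_⟩⟩
  rcases a with i | i <;> rcases b with j | j
  · simp [f]
  · have : G.Adj x (g j) := (g j).2
    simpa [f] using this
  · have : G.Adj (g i) x := (g i).2.symm
    simpa [f] using this
  · have : ¬ G.Adj (g i : V) (g j) := fun h' => (g j).2.ne (hleaf _ (g i).2 _ h').symm
    simpa [f] using this

/-- A non-claw connected graph with a vertex of degree at least three has a line graph with the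
same property. -/
theorem exists_three_le_ndeg_lineGraph {x : V} (hx : 3 ≤ G.ndeg x)
    (h : G.ndeg x = 3 → ∃ w, G.Adj x w ∧ 2 ≤ G.ndeg w) : ∃ e, 3 ≤ G.lineGraph.ndeg e := by
  -- The degree formula gives at least 3 + 2 - 2 in the first case and 4 + 1 - 2 in the second.
  by_cases h3 : G.ndeg x = 3
  · obtain ⟨w, hw, hdw⟩ := h h3
    refine ⟨⟨s(x, w), hw⟩, ?_⟩
    have := ndeg_lineGraph (mem_edgeSet G |>.2 hw)
    omega
  · obtain ⟨w, -, hw, -, -⟩ := exists_adj_adj_of_two_le_ndeg (show 2 ≤ G.ndeg x by omega)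
    refine ⟨⟨s(x, w), hw⟩, ?_⟩
    have := ndeg_lineGraph (mem_edgeSet G |>.2 hw)
    have := ndeg_pos hw.symm
    omega

end Finite

/-! ### Thin balls and how they descend -/

/-- All vertices at distance at most `r` from `v` have degree at most two. -/
def Thin (G : SimpleGraph V) : ℕ → V → Prop
  | 0, v => G.ndeg v ≤ 2
  | r + 1, v => G.ndeg v ≤ 2 ∧ ∀ w, G.Adj v w → Thin G r w

theorem Thin.ndeg_le {r : ℕ} {v : V} (h : G.Thin r v) : G.ndeg v ≤ 2 := by
  cases r with
  | zero => exact h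
  | succ r => exact h.1

theorem Thin.of_succ {r : ℕ} : ∀ {v : V}, G.Thin (r + 1) v → G.Thin r v := by
  induction r with
  | zero => exact fun h => h.1
  | succ r ih => exact fun h => ⟨h.1, fun w hw => ih (h.2 w hw)⟩

theorem Thin.mono {r s : ℕ} (hrs : r ≤ s) {v : V} (h : G.Thin s v) : G.Thin r v := by
  induction s, hrs using Nat.le_induction with
  | base => exact h
  | succ s _ ih => exact ih h.of_succ

theorem Thin.ndeg_le_of_walk {r : ℕ} {v w : V} (p : G.Walk v w) (hp : p.length ≤ r)
    (h : G.Thin r v) : G.ndeg w ≤ 2 := by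
  induction p generalizing r with
  | nil => exact h.ndeg_le
  | cons hadj p ih =>
    cases r with
    | zero => simp at hp
    | succ r => exact ih (by simpa using hp) (h.2 _ hadj)

theorem Connected.not_thin [Finite V] (hG : G.Connected) {x : V} (hx : 3 ≤ G.ndeg x) {r : ℕ}
    (hr : Nat.card V ≤ r) (v : V) : ¬ G.Thin r v := by
  classical
  have := Fintype.ofFinite V
  intro h
  obtain ⟨p, hp⟩ := hG.exists_isPath v x
  have h1 := hp.length_lt
  rw [← Nat.card_eq_fintype_card] at h1
  have := h.ndeg_le_of_walk p (by omega)
  omega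

variable [Finite V]

/-- Descending from L(G) to G keeps the radius and allows either endpoint as centre. Positive radius
is needed: an edge joining a leaf to a vertex of degree three has degree only two. -/
theorem Thin.of_lineGraph (hG : ∀ x, G.ndeg x = 3 → ∃ w, G.Adj x w ∧ 2 ≤ G.ndeg w) {r : ℕ} :
    ∀ {x y : V} (h : G.Adj x y), G.lineGraph.Thin (r + 1) ⟨s(x, y), h⟩ → G.Thin (r + 1) x := by
  have hadj : ∀ {s : ℕ} {x y w : V} (h : G.Adj x y) (hw : G.Adj x w),
      G.lineGraph.Thin (s + 1) ⟨s(x, y), h⟩ → G.lineGraph.Thin s ⟨s(x, w), hw⟩ := by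
    intro s x y w h hw ht
    by_cases hyw : y = w
    · subst hyw
      exact ht.of_succ
    · exact ht.2 _ (lineGraph_adj_of_adj h hw hyw)
  have hdeg : ∀ {x y : V} (h : G.Adj x y), G.lineGraph.Thin 1 ⟨s(x, y), h⟩ → G.ndeg x ≤ 2 := by
    intro x y h ht
    by_contra! hx
    have h1 := ht.ndeg_le
    have h2 := ndeg_lineGraph (mem_edgeSet G |>.2 h)
    have h3 := ndeg_pos h.symm
    -- The bound deg x + deg y ≤ 4 forces deg x = 3; then the edge xw has degree at least 3 + 2 - 2,
    -- yet lies within distance one of xy.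
    obtain ⟨w, hw, hdw⟩ := hG x (by omega)
    have h4 := (hadj h hw ht).ndeg_le
    have h5 := ndeg_lineGraph (mem_edgeSet G |>.2 hw)
    omega
  induction r with
  | zero =>
    intro x y h ht
    refine ⟨hdeg h ht, fun w hw => ?_⟩
    have h4 := (hadj h hw ht).ndeg_le
    have h5 := ndeg_lineGraph (mem_edgeSet G |>.2 hw)
    change G.ndeg w ≤ 2
    by_cases hyw : y = w
    · subst hyw
      refine hdeg h.symm ?_
      convert ht using 2
      exact Subtype.ext Sym2.eq_swap
    · have := two_le_ndeg h hw hyw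
      omega
  | succ r ih =>
    intro x y h ht
    refine ⟨hdeg h (ht.mono (by omega)), fun w hw => ih hw.symm (y := x) ?_⟩
    convert hadj h hw ht using 2
    exact Subtype.ext Sym2.eq_swap

/-- A thin ball in the second line graph comes from a larger thin ball. -/
theorem exists_thin_succ (hG : ∀ x, G.ndeg x = 3 → ∃ w, G.Adj x w ∧ 2 ≤ G.ndeg w)
    (hL : ∀ e, G.lineGraph.ndeg e = 3 → ∃ f, G.lineGraph.Adj e f ∧ 2 ≤ G.lineGraph.ndeg f)
    {r : ℕ} {v : G.lineGraph.edgeSet} (hv : G.lineGraph.lineGraph.Thin (r + 1) v) :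
    ∃ y, G.Thin (r + 2) y := by
  obtain ⟨⟨e, f⟩, hef⟩ := v
  have he : G.lineGraph.Thin (r + 1) e := Thin.of_lineGraph hL hef hv
  have hf : G.lineGraph.Thin (r + 1) f := by
    refine Thin.of_lineGraph hL (Adj.symm hef) ?_
    convert hv using 2
    exact Subtype.ext Sym2.eq_swap
  -- The radius grows here: x, y and z are all centres of thin balls of radius `r + 1`, and x, z are
  -- the only neighbours of y.
  obtain ⟨y, x, z, hx, hz, hxz, rfl, rfl⟩ := exists_of_lineGraph_adj hef
  have hy := Thin.of_lineGraph hG hx he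
  refine ⟨y, hy.ndeg_le, fun w hw => ?_⟩
  rcases eq_or_eq_of_ndeg_le_two hy.ndeg_le hx hz hxz hw with rfl | rfl
  · refine Thin.of_lineGraph hG hx.symm ?_
    convert he using 2
    exact Subtype.ext Sym2.eq_swap
  · refine Thin.of_lineGraph hG hz.symm ?_
    convert hf using 2
    exact Subtype.ext Sym2.eq_swap

/-- If every vertex is at distance at most one from a vertex of degree at least three, then the
line graph has minimum degree at least two. -/
theorem two_le_ndeg_lineGraph (h : ∀ v, ¬ G.Thin 1 v) (e : G.edgeSet) :
    2 ≤ G.lineGraph.ndeg e := by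
  obtain ⟨⟨x, y⟩, he⟩ := e
  have key : ∀ {x y}, G.Adj x y → G.ndeg x = 1 → 3 ≤ G.ndeg y := by
    intro x y hxy hx
    by_contra! hy
    refine h x ⟨by omega, fun w hw => ?_⟩
    change G.ndeg w ≤ 2
    by_cases hwy : y = w
    · subst hwy; omega
    · have := two_le_ndeg hxy hw hwy
      omega
  have hxy : G.Adj x y := he
  have h1 := ndeg_lineGraph he
  have h2 := ndeg_pos hxy
  have h3 := ndeg_pos hxy.symm
  have h4 := key hxy
  have h5 := key hxy.symm
  change 2 ≤ G.lineGraph.ndeg ⟨s(x, y), he⟩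
  omega

/-- In a line graph of a graph of minimum degree two all of whose vertices are at distance at most
one from a vertex of degree at least three, no two vertices of degree two are adjacent. -/
theorem three_le_ndeg_lineGraph_lineGraph (h : ∀ v, ¬ G.Thin 1 v) (h2 : ∀ v, 2 ≤ G.ndeg v)
    (e : G.lineGraph.edgeSet) : 3 ≤ G.lineGraph.lineGraph.ndeg e := by
  obtain ⟨⟨e, f⟩, hef⟩ := e
  have h1 := ndeg_lineGraph hef
  change 3 ≤ G.lineGraph.lineGraph.ndeg ⟨s(e, f), hef⟩
  obtain ⟨y, x, z, hx, hz, hxz, rfl, rfl⟩ := exists_of_lineGraph_adj hef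
  have h3 := ndeg_lineGraph (mem_edgeSet G |>.2 hx)
  have h4 := ndeg_lineGraph (mem_edgeSet G |>.2 hz)
  have hx2 := h2 x
  have hy2 := h2 y
  have hz2 := h2 z
  -- Otherwise deg x + 2 deg y + deg z ≤ 8, so all three degrees are two and y is the centre of a
  -- thin ball.
  by_contra! hcon
  refine h y ⟨by omega, fun w hw => ?_⟩
  change G.ndeg w ≤ 2
  rcases eq_or_eq_of_ndeg_le_two (by omega) hx hz hxz hw with rfl | rfl <;> omega

end SimpleGraph

/-! ### Prolific graphs and growth of the minimum degree -/

namespace FinGraph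

open SimpleGraph

variable {G : FinGraph.{u}}

theorem Prolific.exists_three_le_ndeg (hG : G.Prolific) : ∃ v, 3 ≤ G.graph.ndeg v := by
  by_contra! h
  rcases hG.connected.exists_iso_path_or_cycle (fun v => Nat.lt_succ_iff.1 (h v)) with
    ⟨n, ⟨f⟩⟩ | ⟨n, hn, ⟨f⟩⟩
  · exact (hG.not_path n).false f
  · exact (hG.not_cycle n hn).false f

theorem Prolific.exists_two_le_ndeg (hG : G.Prolific) (x : G.V) (hx : G.graph.ndeg x = 3) :
    ∃ w, G.graph.Adj x w ∧ 2 ≤ G.graph.ndeg w := by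
  by_contra! h
  obtain ⟨f⟩ := hG.connected.exists_iso_claw hx fun w hw => Nat.lt_succ_iff.1 (h w hw)
  exact hG.not_claw.false f

/-- A vertex of degree at least three survives in the line graph, ruling out paths and cycles; the
claw is not a line graph. -/
theorem Prolific.lineGraph (hG : G.Prolific) : G.lineGraph.Prolific := by
  obtain ⟨x, hx⟩ := hG.exists_three_le_ndeg
  obtain ⟨e, he⟩ := exists_three_le_ndeg_lineGraph hx (hG.exists_two_le_ndeg x)
  have he' : 3 ≤ G.lineGraph.graph.ndeg e := he
  refine ⟨{ preconnected := hG.connected.preconnected.lineGraph, nonempty := ⟨e⟩ }, fun n => ⟨fun f => ?_⟩,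
    fun n hn => ⟨fun f => ?_⟩, ⟨fun f => ?_⟩⟩
  · have := f.ndeg_eq e
    have := ndeg_pathGraph_le (f e)
    omega
  · have := f.ndeg_eq e
    have := ndeg_cycleGraph_le hn (f e)
    omega
  · have hadj : ∀ i, G.lineGraph.graph.Adj (f.symm (.inl 0)) (f.symm (.inr i)) := fun i => by
      rw [f.symm.map_adj_iff]; simp
    have hn : ∀ i j, ¬ G.lineGraph.graph.Adj (f.symm (.inr i)) (f.symm (.inr j)) := fun i j => by
      rw [f.symm.map_adj_iff]; simp
    have hne : ∀ i j : Fin 3, i ≠ j → f.symm (.inr i) ≠ f.symm (.inr j) := fun i j hij h =>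
      hij (Sum.inr_injective (f.symm.injective h))
    rcases lineGraph_claw_free (hadj 0) (hadj 1) (hadj 2) (hne 0 1 (by decide))
      (hne 0 2 (by decide)) (hne 1 2 (by decide)) with h | h | h
    · exact hn _ _ h
    · exact hn _ _ h
    · exact hn _ _ h

theorem Prolific.iterate (hG : G.Prolific) (k : ℕ) : (FinGraph.lineGraph^[k] G).Prolific := by
  induction k with
  | zero => exact hG
  | succ k ih => rw [Function.iterate_succ_apply']; exact ih.lineGraph

theorem Prolific.exists_thin_of_iterate (hG : G.Prolific) (k : ℕ) :
    ∀ r, (∃ v, (FinGraph.lineGraph^[2 * k] G).graph.Thin (r + 1) v) →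
      ∃ v, G.graph.Thin (r + 1 + k) v := by
  induction k with
  | zero => exact fun r h => h
  | succ k ih =>
    rintro r ⟨v, hv⟩
    have h : FinGraph.lineGraph^[2 * (k + 1)] G =
        (FinGraph.lineGraph^[2 * k] G).lineGraph.lineGraph := by
      rw [show 2 * (k + 1) = 2 * k + 1 + 1 by ring, Function.iterate_succ_apply',
        Function.iterate_succ_apply']
    revert v
    rw [h]
    intro v hv
    have hP := hG.iterate (2 * k)
    obtain ⟨w, hw⟩ := ih (r + 1) (exists_thin_succ hP.exists_two_le_ndeg
      hP.lineGraph.exists_two_le_ndeg hv)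
    exact ⟨w, by rwa [show r + 1 + (k + 1) = r + 1 + 1 + k by ring]⟩

theorem Prolific.exists_forall_not_thin (hG : G.Prolific) :
    ∃ K, ∀ k ≥ K, ∀ v, ¬ (FinGraph.lineGraph^[2 * k] G).graph.Thin 1 v := by
  obtain ⟨x, hx⟩ := hG.exists_three_le_ndeg
  refine ⟨Nat.card G.V, fun k hk v hv => ?_⟩
  obtain ⟨w, hw⟩ := hG.exists_thin_of_iterate k 0 ⟨v, hv⟩
  exact hG.connected.not_thin hx (by omega) w hw

/-- Iterated line graphs of a prolific graph eventually have minimum degree at least three. -/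
theorem Prolific.exists_three_le (hG : G.Prolific) :
    ∃ k, ∀ v, 3 ≤ (FinGraph.lineGraph^[k] G).graph.ndeg v := by
  -- Only even iterates are controlled, so the odd ones come from applying the result to L(G).
  -- Absence of thin balls is needed at two consecutive levels.
  obtain ⟨K₁, h₁⟩ := hG.exists_forall_not_thin
  obtain ⟨K₂, h₂⟩ := hG.lineGraph.exists_forall_not_thin
  set K := max K₁ K₂
  have h1 := h₁ K (le_max_left _ _)
  have h2 := h₂ K (le_max_right _ _)
  rw [← Function.iterate_succ_apply, Function.iterate_succ_apply'] at h2
  have h3 : FinGraph.lineGraph^[2 * K + 1 + 1 + 1] G =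
      (FinGraph.lineGraph^[2 * K] G).lineGraph.lineGraph.lineGraph := by
    simp only [Function.iterate_succ_apply']
  refine ⟨2 * K + 1 + 1 + 1, ?_⟩
  rw [h3]
  exact three_le_ndeg_lineGraph_lineGraph h2 (two_le_ndeg_lineGraph h1)

theorem le_ndeg_lineGraph {d : ℕ} (h : ∀ v, d ≤ G.graph.ndeg v) (e : G.lineGraph.V) :
    2 * d - 2 ≤ G.lineGraph.graph.ndeg e := by
  obtain ⟨⟨x, y⟩, he⟩ := e
  have h1 := ndeg_lineGraph he
  have h2 := h x
  have h3 := h y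
  change 2 * d - 2 ≤ G.graph.lineGraph.ndeg ⟨s(x, y), he⟩
  omega

/-- The minimum degree of the iterated line graphs of a prolific graph tends to infinity. -/
theorem Prolific.eventually_le_ndeg (hG : G.Prolific) (d : ℕ) :
    ∀ᶠ k in atTop, ∀ v, d ≤ (FinGraph.lineGraph^[k] G).graph.ndeg v := by
  obtain ⟨K, hK⟩ := hG.exists_three_le
  -- Three is the threshold: 2d - 2 ≥ d + 1 exactly when d ≥ 3.
  have key : ∀ j, ∀ v, 3 + j ≤ (FinGraph.lineGraph^[K + j] G).graph.ndeg v := by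
    intro j
    induction j with
    | zero => exact hK
    | succ j ih =>
      rw [← add_assoc, Function.iterate_succ_apply']
      intro v
      have := le_ndeg_lineGraph ih v
      omega
  filter_upwards [eventually_ge_atTop (K + d)] with k hk v
  obtain ⟨j, rfl⟩ := Nat.exists_eq_add_of_le (show K ≤ k by omega)
  have := key j v
  omega

end FinGraph

/-! ### Comparisons between parameters -/

namespace FinGraph

open SimpleGraph

variable {G : FinGraph.{u}}

theorem minDegree_le_ndeg (v : G.V) : G.minDegree ≤ G.graph.ndeg v := by
  classical
  rw [ndeg_eq_degree]
  exact G.graph.minDegree_le_degree v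

theorem ndeg_le_maxDegree (v : G.V) : G.graph.ndeg v ≤ G.maxDegree := by
  classical
  rw [ndeg_eq_degree]
  exact G.graph.degree_le_maxDegree v

theorem le_minDegree [Nonempty G.V] {d : ℕ} (h : ∀ v, d ≤ G.graph.ndeg v) :
    d ≤ G.minDegree := by
  classical
  exact G.graph.le_minDegree_of_forall_le_degree d fun v => ndeg_eq_degree (G := G.graph) v ▸ h v

theorem maxDegree_le {d : ℕ} (h : ∀ v, G.graph.ndeg v ≤ d) : G.maxDegree ≤ d := by
  classical
  exact G.graph.maxDegree_le_of_forall_degree_le d fun v => ndeg_eq_degree (G := G.graph) v ▸ h v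

/-- Unboundedness passes to parameters which dominate an unbounded one, up to a shift of the
iteration and an additive constant. -/
theorem IsUnbounded.of_le_add {P Q : FinGraph.{u} → ℕ} (hQ : IsUnbounded Q) (a b c : ℕ)
    (h : ∀ G : FinGraph.{u}, G.Prolific → Q (lineGraph^[a] G) ≤ P (lineGraph^[b] G) + c) :
    IsUnbounded P := by
  intro G hG
  rw [← tendsto_add_atTop_iff_nat b]
  have h1 : Tendsto (fun k => Q (lineGraph^[k + a] G)) atTop atTop :=
    (tendsto_add_atTop_iff_nat a).2 (hQ G hG)
  rw [tendsto_atTop] at h1 ⊢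
  intro m
  filter_upwards [h1 (m + c)] with k hk
  have := h _ (hG.iterate k)
  rw [← Function.iterate_add_apply, ← Function.iterate_add_apply, add_comm a, add_comm b] at this
  omega

theorem isUnbounded_minDegree : IsUnbounded minDegree.{u} := by
  intro G hG
  rw [tendsto_atTop]
  intro d
  filter_upwards [hG.eventually_le_ndeg d] with k hk
  have := (hG.iterate k).connected.nonempty
  exact le_minDegree hk

theorem Prolific.minDegree_le_maxDegree (hG : G.Prolific) : G.minDegree ≤ G.maxDegree := by
  obtain ⟨v⟩ := hG.connected.nonempty
  exact (minDegree_le_ndeg v).trans (ndeg_le_maxDegree v)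

theorem Prolific.minDegree_le_averageDegree (hG : G.Prolific) :
    (G.minDegree : ℝ) ≤ G.averageDegree := by
  classical
  have := hG.connected.nonempty
  rw [averageDegree, le_div_iff₀ (by exact_mod_cast Fintype.card_pos), mul_comm, ← nsmul_eq_mul]
  refine Finset.card_nsmul_le_sum _ _ _ fun v _ => ?_
  have := minDegree_le_ndeg v
  rw [ndeg_eq_degree] at this
  exact_mod_cast this

theorem numVertices_lineGraph : G.lineGraph.numVertices = G.numEdges := rfl

/-- The edges at a vertex, as vertices of the line graph. -/
def star (G : FinGraph.{u}) (v : G.V) : Set G.graph.edgeSet := {e | v ∈ (e : Sym2 G.V)}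

theorem ncard_star (v : G.V) : (G.star v).ncard = G.graph.ndeg v := by
  rw [← ncard_incidenceSet, ← Set.ncard_image_of_injective _ Subtype.val_injective]
  congr 1
  ext e
  simp only [star, Set.mem_image, incidenceSet]
  constructor
  · rintro ⟨e, he, rfl⟩
    exact ⟨e.2, he⟩
  · rintro ⟨h1, h2⟩
    exact ⟨⟨e, h1⟩, h2, rfl⟩

theorem adj_of_mem_star {v : G.V} {e f : G.graph.edgeSet} (he : e ∈ G.star v) (hf : f ∈ G.star v)
    (h : e ≠ f) : G.graph.lineGraph.Adj e f :=
  lineGraph_adj_iff_exists.2 ⟨h, v, he, hf⟩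

theorem ndeg_le_cliqueNumber_lineGraph (v : G.V) :
    G.graph.ndeg v ≤ G.lineGraph.cliqueNumber := by
  classical
  have h : G.graph.lineGraph.IsClique (G.star v).toFinset := by
    intro e he f hf hef
    exact adj_of_mem_star (by simpa using he) (by simpa using hf) hef
  rw [← ncard_star, Set.ncard_eq_toFinset_card']
  exact IsClique.card_le_cliqueNum (tc := h)

theorem cliqueNumber_le_chromaticNumber : G.cliqueNumber ≤ G.chromaticNumber := by
  have h := G.graph.cliqueNum_le_chromaticNumber
  -- Finiteness matters because `toNat` sends `⊤` to 0.
  have hfin : G.graph.chromaticNumber ≠ ⊤ :=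
    chromaticNumber_ne_top_iff_exists.2 ⟨_, G.graph.colorable_of_fintype⟩
  exact ENat.natCast_le_natCast.1 (h.trans (ENat.natCast_toNat hfin).ge)

/-- A cycle without its first edge is a path. Boundedness is needed because `sSup` of an unbounded
set of naturals is 0. -/
theorem bddAbove_cycleLengths : BddAbove {l : ℕ | ∃ (v : G.V) (w : G.graph.Walk v v),
    w.IsCycle ∧ w.length = l} := by
  refine ⟨Fintype.card G.V, ?_⟩
  rintro l ⟨v, w, hw, rfl⟩
  have h1 := hw.isPath_tail.length_lt
  have h2 := w.length_tail_add_one hw.not_nil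
  omega

/-- A clique on at least three vertices contains a spanning cycle; the constant 2 absorbs smaller
cliques. -/
theorem cliqueNumber_le_longestCycle : G.cliqueNumber ≤ G.longestCycle + 2 := by
  rcases le_or_gt G.cliqueNumber 2 with h | h
  · omega
  obtain ⟨s, hs⟩ := G.graph.exists_isNClique_cliqueNum
  have h1 : ¬ G.graph.CliqueFree G.cliqueNumber := fun h => h s hs
  have h2 : cycleGraph G.cliqueNumber ⊑ G.graph :=
    (IsContained.of_le le_top).trans ((not_cliqueFree_iff_top_isContained _).1 h1)
  have := le_csSup bddAbove_cycleLengths ((cycleGraph_isContained_iff h).1 h2)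
  exact this.trans (by simp [longestCycle])

theorem ndeg_le_chromaticIndex (v : G.V) : G.graph.ndeg v ≤ G.chromaticIndex := by
  have hne : {m : ℕ | ∃ c : G.graph.edgeSet → Fin m, ∀ e f : G.graph.edgeSet, e ≠ f →
      (∃ v : G.V, v ∈ (e : Sym2 G.V) ∧ v ∈ (f : Sym2 G.V)) → c e ≠ c f}.Nonempty :=
    ⟨_, Finite.equivFin _, fun e f hef _ h => hef ((Finite.equivFin _).injective h)⟩
  obtain ⟨c, hc⟩ := Nat.sInf_mem hne
  have h := Set.ncard_le_ncard_of_injOn (s := G.star v) (t := Set.univ) c (fun _ _ => trivial)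
    (fun e he f hf hef => by
      by_contra hne
      exact hc e f hne ⟨v, he, hf⟩ hef) (Set.toFinite _)
  rw [ncard_star, Set.ncard_univ, Nat.card_fin] at h
  exact h

/-- An independent set of L(G) is the edge set of a matching whose vertices are the endpoints of
these edges. -/
theorem indepNum_lineGraph_le_matchingNumber :
    G.lineGraph.independenceNumber ≤ G.matchingNumber := by
  obtain ⟨I, hI⟩ := G.graph.lineGraph.exists_isNIndepSet_indepNum
  have huniq : ∀ v w w' (h : G.graph.Adj v w) (h' : G.graph.Adj v w'),
      (⟨s(v, w), h⟩ : G.graph.edgeSet) ∈ I → (⟨s(v, w'), h'⟩ : G.graph.edgeSet) ∈ I → w' = w := by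
    intro v w w' h h' hw hw'
    by_contra hne
    have hadj : G.graph.lineGraph.Adj ⟨s(v, w'), h'⟩ ⟨s(v, w), h⟩ := lineGraph_adj_of_adj h' h hne
    exact hI.isIndepSet hw' hw hadj.ne hadj
  let M : G.graph.Subgraph :=
    { verts := {v | ∃ (w : G.V) (h : G.graph.Adj v w), (⟨s(v, w), h⟩ : G.graph.edgeSet) ∈ I}
      Adj := fun v w => ∃ h : G.graph.Adj v w, (⟨s(v, w), h⟩ : G.graph.edgeSet) ∈ I
      adj_sub := fun h => h.1
      edge_vert := fun h => ⟨_, h⟩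
      symm := ⟨fun v w ⟨h, hI⟩ => ⟨h.symm, by
        convert hI using 1
        exact Subtype.ext Sym2.eq_swap⟩⟩ }
  have hM : M.IsMatching := fun v ⟨w, h, hw⟩ =>
    ⟨w, ⟨h, hw⟩, fun w' ⟨h', hw'⟩ => huniq v w w' h h' hw hw'⟩
  have hE : M.edgeSet = Subtype.val '' (I : Set G.graph.edgeSet) := by
    ext ⟨v, w⟩
    constructor
    · rintro ⟨h, hw⟩
      exact ⟨_, hw, rfl⟩
    · rintro ⟨⟨e, he⟩, heI, rfl⟩
      exact ⟨he, heI⟩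
  have hbdd : BddAbove {m : ℕ | ∃ M : G.graph.Subgraph, M.IsMatching ∧ M.edgeSet.ncard = m} := by
    refine ⟨G.numEdges, ?_⟩
    rintro m ⟨M, -, rfl⟩
    exact Set.ncard_le_ncard M.edgeSet_subset (Set.toFinite _)
  refine le_csSup hbdd ⟨M, hM, ?_⟩
  rw [hE, Set.ncard_image_of_injective _ Subtype.val_injective, Set.ncard_coe_finset]
  exact hI.card_eq

/-! ### Domination -/

theorem exists_indep_dominating (G : FinGraph.{u}) :
    ∃ D : Set G.V, G.graph.IsIndepSet D ∧ G.IsDominating D := by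
  obtain ⟨D, hD⟩ := (Set.toFinite {D : Set G.V | G.graph.IsIndepSet D}).exists_maximal
    ⟨∅, Set.pairwise_empty _⟩
  refine ⟨D, hD.1, fun v hv => ?_⟩
  by_contra! h
  refine hv (hD.2 (y := insert v D) ?_ (Set.subset_insert _ _) (Set.mem_insert _ _))
  exact (Set.pairwise_insert (r := fun v w => ¬ G.graph.Adj v w)).2
    ⟨hD.1, fun b hb _ => ⟨fun h' => h b hb h'.symm, h b hb⟩⟩

theorem dominationNumber_le_independentDominationNumber :
    G.dominationNumber ≤ G.independentDominationNumber := by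
  obtain ⟨D, h1, h2⟩ := G.exists_indep_dominating
  obtain ⟨D, -, h2, h3⟩ := Nat.sInf_mem (s := {m : ℕ | ∃ D : Set G.V, G.graph.IsIndepSet D ∧
    G.IsDominating D ∧ D.ncard = m}) ⟨_, D, h1, h2, rfl⟩
  exact Nat.sInf_le ⟨D, h2, h3⟩

theorem independentDominationNumber_le_independenceNumber :
    G.independentDominationNumber ≤ G.independenceNumber := by
  classical
  obtain ⟨D, h1, h2⟩ := G.exists_indep_dominating
  have h : G.independentDominationNumber ≤ D.ncard := Nat.sInf_le ⟨D, h1, h2, rfl⟩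
  refine h.trans ?_
  rw [Set.ncard_eq_toFinset_card']
  exact IsIndepSet.card_le_indepNum (by simpa using h1)

/-- The closed neighbourhoods of the vertices of `D` cover the graph, and each has at most Δ + 1
elements. -/
theorem IsDominating.card_le {D : Set G.V} (hD : G.IsDominating D) :
    G.numVertices ≤ D.ncard * (G.maxDegree + 1) := by
  classical
  have h : (Finset.univ : Finset G.V) ⊆
      D.toFinset.biUnion fun u => insert u (G.graph.neighborFinset u) := by
    intro v _
    rw [Finset.mem_biUnion]
    by_cases hv : v ∈ D
    · exact ⟨v, by simpa using hv, by simp⟩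
    · obtain ⟨u, hu, huv⟩ := hD v hv
      exact ⟨u, by simpa using hu, by simp [huv]⟩
  rw [numVertices, Nat.card_eq_fintype_card, Set.ncard_eq_toFinset_card']
  refine (Finset.card_le_card h).trans (Finset.card_biUnion_le_card_mul _ _ _ fun u _ => ?_)
  refine (Finset.card_insert_le _ _).trans ?_
  have := ndeg_le_maxDegree u
  rw [ndeg_eq_degree] at this
  simpa using this

theorem le_dominationNumber {t : ℕ} (h : t * (G.maxDegree + 1) ≤ G.numVertices) :
    t ≤ G.dominationNumber := by
  obtain ⟨D, h2, h3⟩ := Nat.sInf_mem (s := {m : ℕ | ∃ D : Set G.V, G.IsDominating D ∧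
    D.ncard = m}) ⟨_, Set.univ, fun v hv => absurd (Set.mem_univ v) hv, rfl⟩
  have h4 := h.trans h2.card_le
  rw [h3] at h4
  exact Nat.le_of_mul_le_mul_right h4 (Nat.succ_pos _)

theorem maxDegree_lineGraph_le : G.lineGraph.maxDegree ≤ 2 * G.maxDegree := by
  refine maxDegree_le fun e => ?_
  obtain ⟨⟨x, y⟩, he⟩ := e
  have h1 := ndeg_lineGraph he
  have h2 := ndeg_le_maxDegree x
  have h3 := ndeg_le_maxDegree y
  change G.graph.lineGraph.ndeg ⟨s(x, y), he⟩ ≤ _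
  omega

theorem mul_numVertices_le {d : ℕ} (h : ∀ v, d ≤ G.graph.ndeg v) :
    G.numVertices * d ≤ 2 * G.numEdges := by
  classical
  have h1 := G.graph.sum_degrees_eq_twice_card_edges
  have h2 : G.numEdges = G.graph.edgeFinset.card := by
    rw [numEdges, Set.ncard_eq_toFinset_card']; rfl
  rw [h2, ← h1, numVertices, Nat.card_eq_fintype_card, ← smul_eq_mul]
  refine Finset.card_nsmul_le_sum _ _ _ fun v _ => ?_
  rw [← ndeg_eq_degree]
  exact h v

theorem Prolific.maxDegree_lt (hG : G.Prolific) : G.maxDegree + 1 ≤ G.numVertices := by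
  classical
  have := hG.connected.nonempty
  rw [numVertices, Nat.card_eq_fintype_card]
  exact G.graph.maxDegree_lt_card_verts

theorem isUnbounded_dominationNumber : IsUnbounded dominationNumber.{u} := by
  intro G hG
  -- With δ ≥ 8 the handshake bound gives e ≥ 4n, so n grows at least fourfold while Δ + 1 at most
  -- doubles.
  obtain ⟨K, hK⟩ := eventually_atTop.1 (hG.eventually_le_ndeg 8)
  have key : ∀ j, 2 ^ j * ((lineGraph^[K + j] G).maxDegree + 1) ≤
      (lineGraph^[K + j] G).numVertices := by
    intro j
    induction j with
    | zero => simpa using (hG.iterate K).maxDegree_lt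
    | succ j ih =>
      have h1 := mul_numVertices_le (hK (K + j) (by omega))
      have h2 := (lineGraph^[K + j] G).maxDegree_lineGraph_le
      rw [← add_assoc, Function.iterate_succ_apply', numVertices_lineGraph]
      calc 2 ^ (j + 1) * ((lineGraph^[K + j] G).lineGraph.maxDegree + 1)
          ≤ 2 ^ (j + 1) * (2 * ((lineGraph^[K + j] G).maxDegree + 1)) :=
            Nat.mul_le_mul_left _ (by omega)
        _ = 4 * (2 ^ j * ((lineGraph^[K + j] G).maxDegree + 1)) := by ring
        _ ≤ 4 * (lineGraph^[K + j] G).numVertices := Nat.mul_le_mul_left _ ih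
        _ ≤ (lineGraph^[K + j] G).numEdges := by omega
  rw [tendsto_atTop]
  intro t
  filter_upwards [eventually_ge_atTop (K + t)] with k hk
  obtain ⟨j, rfl⟩ := Nat.exists_eq_add_of_le (show K ≤ k by omega)
  have h1 := le_dominationNumber (key j)
  have h2 : j < 2 ^ j := Nat.lt_two_pow_self
  omega

/-! ### Edge and vertex connectivity -/

/-- An edge cut of a line graph splits the clique of edges at some vertex. -/
theorem Prolific.minDegree_le_edgeConnectivity_lineGraph (hG : G.Prolific) :
    G.minDegree ≤ G.lineGraph.edgeConnectivity + 1 := by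
  classical
  set L := G.lineGraph
  have hLP : L.Prolific := hG.lineGraph
  obtain ⟨x₀, hx₀⟩ := hLP.exists_three_le_ndeg
  have hne : {m : ℕ | ∃ S : Set (Sym2 L.V), S ⊆ L.graph.edgeSet ∧
      ¬ (L.graph.deleteEdges S).Connected ∧ S.ncard = m}.Nonempty := by
    refine ⟨_, L.graph.edgeSet, subset_rfl, fun h => ?_, rfl⟩
    obtain ⟨a, b, ha, -⟩ := exists_adj_adj_of_two_le_ndeg (show 2 ≤ L.graph.ndeg x₀ by omega)
    obtain ⟨p⟩ := h.preconnected x₀ a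
    cases p with
    | nil => exact ha.ne rfl
    | cons h' _ => simp at h'
  obtain ⟨S, hS, hdis, hcard⟩ := Nat.sInf_mem hne
  have hnp : ¬ (L.graph.deleteEdges S).Preconnected := fun h =>
    hdis { preconnected := h, nonempty := ⟨x₀⟩ }
  simp only [Preconnected, not_forall] at hnp
  obtain ⟨e₀, f₀, hef₀⟩ := hnp
  obtain ⟨e, he, f, hadj, hf⟩ : ∃ e, (L.graph.deleteEdges S).Reachable e₀ e ∧
      ∃ f, L.graph.Adj e f ∧ ¬ (L.graph.deleteEdges S).Reachable e₀ f := by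
    by_contra! hcon
    have := hLP.connected.eq_univ_of_forall_adj
      (S := {e | (L.graph.deleteEdges S).Reachable e₀ e}) ⟨e₀, Reachable.refl _⟩ hcon
    exact hef₀ (this ▸ Set.mem_univ f₀ : f₀ ∈ {e | (L.graph.deleteEdges S).Reachable e₀ e})
  have hcut : ∀ g h, L.graph.Adj g h → (L.graph.deleteEdges S).Reachable e₀ g →
      ¬ (L.graph.deleteEdges S).Reachable e₀ h → s(g, h) ∈ S := by
    intro g h hgh hg hh
    by_contra hn
    exact hh (hg.trans (Adj.reachable (deleteEdges_adj.2 ⟨hgh, hn⟩)))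
  obtain ⟨-, v, hev, hfv⟩ := lineGraph_adj_iff_exists.1 hadj
  -- The crossing pair e, f shares v. Each edge g at v other than e is paired with whichever of e, f
  -- lies on the opposite side, giving deg v - 1 distinct cut edges. Leaving out e avoids counting
  -- the pair ef twice.
  let φ : L.V → Sym2 L.V := fun g =>
    if (L.graph.deleteEdges S).Reachable e₀ g then s(g, f) else s(e, g)
  have hmaps : ∀ g ∈ G.star v \ {e}, φ g ∈ S := by
    rintro g ⟨hg, hge⟩
    by_cases hr : (L.graph.deleteEdges S).Reachable e₀ g
    · simp only [φ, if_pos hr]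
      exact hcut g f (adj_of_mem_star hg hfv fun h => hf (h ▸ hr)) hr hf
    · simp only [φ, if_neg hr]
      exact hcut e g (adj_of_mem_star hev hg (Ne.symm hge)) he hr
  have hinj : Set.InjOn φ (G.star v \ {e}) := by
    rintro g ⟨-, hge⟩ g' ⟨-, hge'⟩ h
    have hge : g ≠ e := hge
    have hge' : g' ≠ e := hge'
    simp only [φ] at h
    split_ifs at h with h1 h2 h2
    · exact Sym2.congr_left.1 h
    · rcases Sym2.eq_iff.1 h with ⟨h3, -⟩ | ⟨-, h3⟩
      · exact absurd h3 hge
      · exact absurd (h3 ▸ he) hf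
    · rcases Sym2.eq_iff.1 h with ⟨h3, -⟩ | ⟨h3, -⟩
      · exact absurd h3.symm hge'
      · exact absurd (h3 ▸ he) hf
    · exact Sym2.congr_right.1 h
  have h1 := Set.ncard_le_ncard_of_injOn φ hmaps hinj (Set.toFinite S)
  have h2 := Set.ncard_sdiff_singleton_add_one (show e ∈ G.star v from hev) (Set.toFinite _)
  have h4 : Set.ncard (G.star v) = G.graph.ndeg v := ncard_star v
  have h5 : G.graph.ndeg v ≤ S.ncard + 1 := (h2.trans h4).ge.trans (Nat.succ_le_succ h1)
  have h3 := minDegree_le_ndeg v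
  change S.ncard = L.edgeConnectivity at hcard
  omega

/-- Deleting few edges of `G` leaves a connected graph, whose line graph is connected. -/
theorem Prolific.edgeConnectivity_le_vertexConnectivity_lineGraph (hG : G.Prolific) :
    G.edgeConnectivity ≤ G.lineGraph.vertexConnectivity := by
  classical
  set L := G.lineGraph
  obtain ⟨e₀⟩ := hG.lineGraph.connected.nonempty
  have hne : {m : ℕ | ∃ S : Set L.V, (¬ (L.graph.induce Sᶜ).Preconnected ∨ Sᶜ.ncard = 1) ∧
      S.ncard = m}.Nonempty := ⟨_, {e₀}ᶜ, .inr (by simp), rfl⟩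
  obtain ⟨S, hS, hcard⟩ := Nat.sInf_mem hne
  change S.ncard = L.vertexConnectivity at hcard
  by_contra! hlt
  set T : Set (Sym2 G.V) := Subtype.val '' S with hT
  have hTc : T.ncard = S.ncard := Set.ncard_image_of_injective _ Subtype.val_injective
  have hTE : T ⊆ G.graph.edgeSet := by
    rintro _ ⟨e, -, rfl⟩
    exact e.2
  have hconn : (G.graph.deleteEdges T).Connected := by
    by_contra hn
    have : G.edgeConnectivity ≤ T.ncard := Nat.sInf_le ⟨T, hTE, hn, rfl⟩
    omega
  have hmem : ∀ {x y : G.V}, (G.graph.deleteEdges T).Adj x y →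
      ∃ h : G.graph.Adj x y, (⟨s(x, y), h⟩ : L.V) ∈ Sᶜ := by
    intro x y h
    rw [deleteEdges_adj] at h
    exact ⟨h.1, fun hs => h.2 ⟨_, hs, rfl⟩⟩
  rcases hS with hS | hS
  · have hsub : ∀ e : (G.graph.deleteEdges T).edgeSet,
        ∃ h : (e : Sym2 G.V) ∈ G.graph.edgeSet, (⟨e, h⟩ : L.V) ∈ Sᶜ := by
      rintro ⟨⟨x, y⟩, he⟩
      exact hmem he
    -- This homomorphism is surjective, so connectedness passes from L(G - T) to what is left of
    -- L(G).
    let f : (G.graph.deleteEdges T).lineGraph →g L.graph.induce Sᶜ :=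
      { toFun := fun e => ⟨⟨e, (hsub e).1⟩, (hsub e).2⟩
        map_rel' := by
          intro e e' h
          rw [lineGraph_adj_iff_exists] at h
          refine lineGraph_adj_iff_exists.2 ⟨fun h' => h.1 (Subtype.ext ?_), h.2⟩
          exact congrArg (fun a : G.graph.edgeSet => (a : Sym2 G.V)) h' }
    refine hS (hconn.preconnected.lineGraph.map f ?_)
    rintro ⟨⟨⟨x, y⟩, he⟩, heS⟩
    refine ⟨⟨s(x, y), ?_⟩, rfl⟩
    refine (deleteEdges_adj.2 ⟨he, ?_⟩ : (G.graph.deleteEdges T).Adj x y)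
    rintro ⟨e', he', h⟩
    exact heS ((Subtype.ext h : e' = ⟨s(x, y), he⟩) ▸ he')
  -- A connected G - T whose only edge is e has just the two ends of e as vertices, but x, a, b are
  -- three.
  · obtain ⟨e, he⟩ := Set.ncard_eq_one.1 hS
    obtain ⟨x, hx⟩ := hG.exists_three_le_ndeg
    obtain ⟨a, b, ha, hb, hab⟩ := exists_adj_adj_of_two_le_ndeg
      (show 2 ≤ G.graph.ndeg x by omega)
    have hin : ∀ v w : G.V, v ≠ w → v ∈ (show G.graph.edgeSet from e).1 := by
      intro v w hvw
      obtain ⟨p⟩ := hconn.preconnected v w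
      cases p with
      | nil => exact absurd rfl hvw
      | cons h _ =>
        obtain ⟨h1, h2⟩ := hmem h
        rw [he] at h2
        rw [← (h2 : _ = e)]
        simp
    have h1 := hin x a ha.ne
    have h2 := hin a x ha.ne'
    have h3 := hin b x hb.ne'
    have h4 := (Sym2.mem_and_mem_iff hab).1 ⟨h2, h3⟩
    rw [h4, Sym2.mem_iff] at h1
    rcases h1 with h1 | h1
    · exact ha.ne h1
    · exact hb.ne h1

end FinGraph

/-! ### Assembly of the fifteen parameters -/

open FinGraph

theorem theorem2p3 :
    FinGraph.IsUnbounded FinGraph.numVertices.{u} ∧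
    FinGraph.IsUnbounded FinGraph.numEdges.{u} ∧
    FinGraph.IsUnbounded FinGraph.maxDegree.{u} ∧
    FinGraph.IsUnbounded FinGraph.minDegree.{u} ∧
    FinGraph.IsUnbounded FinGraph.averageDegree.{u} ∧
    FinGraph.IsUnbounded FinGraph.longestCycle.{u} ∧
    FinGraph.IsUnbounded FinGraph.matchingNumber.{u} ∧
    FinGraph.IsUnbounded FinGraph.chromaticNumber.{u} ∧
    FinGraph.IsUnbounded FinGraph.chromaticIndex.{u} ∧
    FinGraph.IsUnbounded FinGraph.cliqueNumber.{u} ∧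
    FinGraph.IsUnbounded FinGraph.edgeConnectivity.{u} ∧
    FinGraph.IsUnbounded FinGraph.vertexConnectivity.{u} ∧
    FinGraph.IsUnbounded FinGraph.independenceNumber.{u} ∧
    FinGraph.IsUnbounded FinGraph.independentDominationNumber.{u} ∧
    FinGraph.IsUnbounded FinGraph.dominationNumber.{u} := by
  have hδ := isUnbounded_minDegree.{u}
  have hΔ : IsUnbounded maxDegree.{u} := hδ.of_le_add 0 0 0 fun G hG => hG.minDegree_le_maxDegree
  have hn : IsUnbounded numVertices.{u} := hΔ.of_le_add 0 0 0 fun G hG =>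
    (Nat.le_succ _).trans hG.maxDegree_lt
  have he : IsUnbounded numEdges.{u} := hn.of_le_add 1 0 0 fun G _ => le_rfl
  have hω : IsUnbounded cliqueNumber.{u} := hδ.of_le_add 0 1 0 fun G hG => by
    obtain ⟨v⟩ := hG.connected.nonempty
    exact (minDegree_le_ndeg v).trans (ndeg_le_cliqueNumber_lineGraph v)
  have hχ' : IsUnbounded chromaticIndex.{u} := hδ.of_le_add 0 0 0 fun G hG => by
    obtain ⟨v⟩ := hG.connected.nonempty
    exact (minDegree_le_ndeg v).trans (ndeg_le_chromaticIndex v)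
  have hlam : IsUnbounded edgeConnectivity.{u} := hδ.of_le_add 0 1 1 fun G hG =>
    hG.minDegree_le_edgeConnectivity_lineGraph
  have hγ := isUnbounded_dominationNumber.{u}
  have hi : IsUnbounded independentDominationNumber.{u} := hγ.of_le_add 0 0 0 fun G _ =>
    dominationNumber_le_independentDominationNumber
  have hα : IsUnbounded independenceNumber.{u} := hi.of_le_add 0 0 0 fun G _ =>
    independentDominationNumber_le_independenceNumber
  refine ⟨hn, he, hΔ, hδ, fun G hG => ?_, hω.of_le_add 0 0 2 fun G _ => cliqueNumber_le_longestCycle,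
    hα.of_le_add 1 0 0 fun G _ => indepNum_lineGraph_le_matchingNumber,
    hω.of_le_add 0 0 0 fun G _ => cliqueNumber_le_chromaticNumber, hχ', hω, hlam,
    hlam.of_le_add 0 1 0 fun G hG => hG.edgeConnectivity_le_vertexConnectivity_lineGraph,
    hα, hi, hγ⟩
  exact tendsto_atTop_mono (fun k => (hG.iterate k).minDegree_le_averageDegree)
    (tendsto_natCast_atTop_atTop.comp (hδ G hG))
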